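/- **Definitions.** Let $\aleph_0$ be the category with the natural numbers as objects and functions $\{0,\dots,n-1\}\to\{0,\dots,m-1\}$ as maps $n\to m$; it has finite coproducts $(+,0)$ and a symmetric monoidal structure $(\times,1)$ given by multiplication of natural numbers, via the coordinatisation $(a,b)\mapsto a\cdot m+b$ of $n\times m$. A *symmetric monoidal Lawvere theory with biproducts* is a small category $L$ with the natural numbers as objects and with a symmetric monoidal structure $\otimes$, together with a functor $\aleph_0\to L$ that is the identity on objects and strictly preserves the finite coproducts and the symmetric monoidal structure, such that in $L$ the coproducts $(+,0)$ are biproducts, with coprojections $\kappa_i$ and projections $\pi_1=[\mathrm{id},0]$, $\pi_2=[0,\mathrm{id}]$. (Then $\otimes$ distributes over $+$.) With the identity-on-objects functors that strictly preserve all this structure as morphisms they form a category $\mathbf{SMBLaw}$. A *dagger* on $L$ is a functor $\dagger\colon L^{\mathrm{op}}\to L$ that is the identity on objects and satisfies $f^{\dagger\dagger}=f$, $(f\otimes g)^\dagger=f^\dagger\otimes g^\dagger$ and $\pi_i^\dagger=\kappa_i$, and for which the coherence isomorphisms of $\otimes$ (associativity, units, symmetry) have their inverse as dagger. $\mathbf{DSMBLaw}$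 is the category of symmetric monoidal Lawvere theories with biproducts and a dagger, with the $\mathbf{SMBLaw}$-morphisms that commute with the daggers. $\mathbf{CSRng}$ is the category of commutative semirings, and $\mathbf{ICSRng}$ the category of commutative semirings with an involution $*$, that is, a unary operation that preserves $+,0,\cdot,1$ and satisfies $s^{**}=s$, with the semiring homomorphisms that preserve $*$. Let $\mathrm{Mat}\colon\mathbf{CSRng}\to\mathbf{SMBLaw}$ send $S$ to the theory whose maps $n\to m$ are the $n\times m$ matrices over $S$, with composition $(h\circ g)(i,k)=\sum_j g(i,j)\cdot h(j,k)$ and tensor $(g\otimes h)((i_0,i_1),(j_0,j_1))=g(i_0,j_0)\cdot h(i_1,j_1)$, and send a homomorphism to its entrywise application. Let $H\colon\mathbf{SMBLaw}\to\mathbf{CSRng}$ send $L$ to the set $L(1,1)$ with composition as multiplication and with addition $s+t=\nabla\circ(s\oplus t)\circ\Delta$, and send a functor to its restriction to $L(1,1)$. **Lemma.** The functors $\mathrm{Mat}$ and $H$ restrict to functors $\mathrm{Mat}\colon\mathbf{ICSRng}\rightleftarrows\mathbf{DSMBLaw}\colon H$: for every involutive commutative semiring $S$, conjugate transposition $f^\dagger(i,j)=f(j,i)^*$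 is a dagger on $\mathrm{Mat}(S)$, with which $\mathrm{Mat}(f)$ commutes for every morphism $f$ of $\mathbf{ICSRng}$; and for every $L$ in $\mathbf{DSMBLaw}$ the map $s\mapsto s^\dagger$ is an involution on $L(1,1)$, with which $H(F)$ commutes for every morphism $F$ of $\mathbf{DSMBLaw}$. There is an adjunction $\mathrm{Mat}\dashv H$ between $\mathbf{CSRng}$ and $\mathbf{SMBLaw}$ under which $F\colon\mathrm{Mat}(S)\to L$ corresponds to the homomorphism $S\to L(1,1)$ that sends $s$ to the image under $F$ of the $1\times1$ matrix $(s)$, and it restricts to an adjunction $\mathrm{Mat}\dashv H$ between $\mathbf{ICSRng}$ and $\mathbf{DSMBLaw}$: the unit and the counit of the latter have the unit and the counit of the former as underlying morphisms. -/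

import Mathlib

open CategoryTheory

universe u

namespace LawTheory

/-! ### The category `ℵ₀`: objects are natural numbers, maps `n → m` are functions `Fin n → Fin m`

It has coproducts `n + m` and a symmetric monoidal structure given by multiplication `n * m`
through the coordinatisation `Fin n × Fin m ≃ Fin (n * m)`, `(a, b) ↦ a * m + b`
(this is Mathlib's `finProdFinEquiv`). -/

namespace Aleph

/-- The tensor of two functions between finite ordinals: `a ⊗ b ↦ f a ⊗ g b`. -/
def tensor {n m p q : ℕ} (f : Fin n → Fin p) (g : Fin m → Fin q) : Fin (n * m) → Fin (p * q) :=
  fun c => finProdFinEquiv (Prod.map f g (finProdFinEquiv.symm c))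

/-- The associativity isomorphism `a ⊗ (b ⊗ c) ↦ (a ⊗ b) ⊗ c`. -/
def assoc (n m k : ℕ) : Fin (n * (m * k)) ≃ Fin (n * m * k) :=
  finProdFinEquiv.symm.trans <|
    ((Equiv.refl _).prodCongr finProdFinEquiv.symm).trans <|
      (Equiv.prodAssoc _ _ _).symm.trans <|
        (finProdFinEquiv.prodCongr (Equiv.refl _)).trans finProdFinEquiv

/-- The left unit isomorphism `0 ⊗ a ↦ a`. -/
def leftUnitor (n : ℕ) : Fin (1 * n) ≃ Fin n :=
  finProdFinEquiv.symm.trans (Equiv.uniqueProd (Fin n) (Fin 1))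

/-- The right unit isomorphism `a ⊗ 0 ↦ a`. -/
def rightUnitor (n : ℕ) : Fin (n * 1) ≃ Fin n :=
  finProdFinEquiv.symm.trans (Equiv.prodUnique (Fin n) (Fin 1))

/-- The symmetry `a ⊗ b ↦ b ⊗ a`. -/
def braid (n m : ℕ) : Fin (n * m) ≃ Fin (m * n) :=
  finProdFinEquiv.symm.trans ((Equiv.prodComm _ _).trans finProdFinEquiv)

/-- The distributivity isomorphism `n ⊗ m + n ⊗ k → n ⊗ (m + k)`. -/
def distrib (n m k : ℕ) : Fin (n * m + n * k) ≃ Fin (n * (m + k)) :=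
  finSumFinEquiv.symm.trans <|
    (finProdFinEquiv.symm.sumCongr finProdFinEquiv.symm).trans <|
      (Equiv.prodSumDistrib _ _ _).symm.trans <|
        ((Equiv.refl _).prodCongr finSumFinEquiv).trans finProdFinEquiv

end Aleph

/-! ### Lawvere theories -/

/-- A Lawvere theory: a small category with the natural numbers as objects, with a functor `incl`
from `ℵ₀` that is the identity on objects and makes `(+, 0)` finite coproducts.
Composition `comp f g` is in diagrammatic order (first `f`, then `g`). -/
structure Law where
  Hom : ℕ → ℕ → Type u
  id : ∀ n, Hom n n
  comp : ∀ {n m p}, Hom n m → Hom m p → Hom n p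
  id_comp : ∀ {n m} (f : Hom n m), comp (id n) f = f
  comp_id : ∀ {n m} (f : Hom n m), comp f (id m) = f
  comp_assoc : ∀ {n m p q} (f : Hom n m) (g : Hom m p) (h : Hom p q),
    comp (comp f g) h = comp f (comp g h)
  incl : ∀ {n m}, (Fin n → Fin m) → Hom n m
  incl_id : ∀ n, incl (fun i : Fin n => i) = id n
  incl_comp : ∀ {n m p} (f : Fin n → Fin m) (g : Fin m → Fin p),
    incl (fun i => g (f i)) = comp (incl f) (incl g)
  /-- `0` is an initial object. -/
  initial_uniq : ∀ {m} (f g : Hom 0 m), f = g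
  /-- The cotuple `[f, g]`. -/
  desc : ∀ {n m p}, Hom n p → Hom m p → Hom (n + m) p
  inl_desc : ∀ {n m p} (f : Hom n p) (g : Hom m p), comp (incl (Fin.castAdd m)) (desc f g) = f
  inr_desc : ∀ {n m p} (f : Hom n p) (g : Hom m p), comp (incl (Fin.natAdd n)) (desc f g) = g
  desc_uniq : ∀ {n m p} (f : Hom n p) (g : Hom m p) (h : Hom (n + m) p),
    comp (incl (Fin.castAdd m)) h = f → comp (incl (Fin.natAdd n)) h = g → h = desc f g

namespace Law

variable (L : Law.{u})

/-- The coprojection `κ₁ : n → n + m`. -/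
def inl (n m : ℕ) : L.Hom n (n + m) := L.incl (Fin.castAdd m)

/-- The coprojection `κ₂ : m → n + m`. -/
def inr (n m : ℕ) : L.Hom m (n + m) := L.incl (Fin.natAdd n)

/-- The unique map `0 → n`. -/
def fromZero (n : ℕ) : L.Hom 0 n := L.incl Fin.elim0

end Law

/-- A symmetric monoidal Lawvere theory: a Lawvere theory with a symmetric monoidal structure that
is strictly preserved by the functor from `ℵ₀`. So the tensor is multiplication on objects, the
tensor unit is `1`, and the coherence isomorphisms are the images of those of `ℵ₀`; they have to be
natural for all maps of the theory. The pentagon, triangle and hexagon hold because they hold in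
`ℵ₀` (see the instances `SMLaw.instMonoidal` and `SMLaw.instSymmetric` below), and the tensor
distributes over the coproducts because the canonical map `n ⊗ m + n ⊗ k → n ⊗ (m + k)` is the
image of a bijection (`SMLaw.desc_tensor`). -/
structure SMLaw extends Law.{u} where
  tensor : ∀ {n m p q}, Hom n p → Hom m q → Hom (n * m) (p * q)
  tensor_id : ∀ n m, tensor (id n) (id m) = id (n * m)
  tensor_comp : ∀ {n m p q r s} (f : Hom n p) (g : Hom m q) (f' : Hom p r) (g' : Hom q s),
    tensor (comp f f') (comp g g') = comp (tensor f g) (tensor f' g')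
  tensor_incl : ∀ {n m p q} (f : Fin n → Fin p) (g : Fin m → Fin q),
    tensor (incl f) (incl g) = incl (Aleph.tensor f g)
  assoc_natural : ∀ {n m k n' m' k'} (f : Hom n n') (g : Hom m m') (h : Hom k k'),
    comp (tensor f (tensor g h)) (incl (Aleph.assoc n' m' k')) =
      comp (incl (Aleph.assoc n m k)) (tensor (tensor f g) h)
  leftUnitor_natural : ∀ {n m} (f : Hom n m),
    comp (tensor (id 1) f) (incl (Aleph.leftUnitor m)) = comp (incl (Aleph.leftUnitor n)) f
  rightUnitor_natural : ∀ {n m} (f : Hom n m),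
    comp (tensor f (id 1)) (incl (Aleph.rightUnitor m)) = comp (incl (Aleph.rightUnitor n)) f
  braid_natural : ∀ {n m n' m'} (f : Hom n n') (g : Hom m m'),
    comp (tensor f g) (incl (Aleph.braid n' m')) = comp (incl (Aleph.braid n m)) (tensor g f)

/-- A symmetric monoidal Lawvere theory with biproducts: `0` is also terminal, so a zero object,
and the coproduct `n + m` is also a product, with projections `π₁ = [id, 0]` and `π₂ = [0, id]`. -/
structure SMBLaw extends SMLaw.{u} where
  toZero : ∀ n, Hom n 0
  terminal_uniq : ∀ {n} (f g : Hom n 0), f = g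
  fst : ∀ n m, Hom (n + m) n
  snd : ∀ n m, Hom (n + m) m
  inl_fst : ∀ n m, comp (toLaw.inl n m) (fst n m) = id n
  inr_fst : ∀ n m, comp (toLaw.inr n m) (fst n m) = comp (toZero m) (toLaw.fromZero n)
  inl_snd : ∀ n m, comp (toLaw.inl n m) (snd n m) = comp (toZero n) (toLaw.fromZero m)
  inr_snd : ∀ n m, comp (toLaw.inr n m) (snd n m) = id m
  /-- The tuple `⟨f, g⟩`. -/
  lift : ∀ {n m p}, Hom p n → Hom p m → Hom p (n + m)
  lift_fst : ∀ {n m p} (f : Hom p n) (g : Hom p m), comp (lift f g) (fst n m) = f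
  lift_snd : ∀ {n m p} (f : Hom p n) (g : Hom p m), comp (lift f g) (snd n m) = g
  lift_uniq : ∀ {n m p} (f : Hom p n) (g : Hom p m) (h : Hom p (n + m)),
    comp h (fst n m) = f → comp h (snd n m) = g → h = lift f g

/-! ### The Mathlib symmetric monoidal category given by a symmetric monoidal Lawvere theory -/

namespace SMLaw

/-- The objects of a symmetric monoidal Lawvere theory: the natural numbers. -/
def Obj (_ : SMLaw.{u}) : Type := ℕ

variable (L : SMLaw.{u})

instance instCategory : Category.{u} L.Obj where
  Hom n m := L.Hom n m
  id n := L.id n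
  comp f g := L.comp f g
  id_comp f := L.id_comp f
  comp_id f := L.comp_id f
  assoc f g h := L.comp_assoc f g h

/-- The isomorphism in `L` given by a bijection between finite ordinals. -/
def inclIso {n m : ℕ} (e : Fin n ≃ Fin m) : @Iso L.Obj _ n m where
  hom := L.incl e
  inv := L.incl e.symm
  hom_inv_id := by
    refine (L.incl_comp e e.symm).symm.trans ?_
    simp only [Equiv.symm_apply_apply]
    exact L.incl_id n
  inv_hom_id := by
    refine (L.incl_comp e.symm e).symm.trans ?_
    simp only [Equiv.apply_symm_apply]
    exact L.incl_id m

/-- The canonical map `n ⊗ m + n ⊗ k → n ⊗ (m + k)` is an isomorphism. -/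
theorem desc_tensor (n m k : ℕ) :
    L.desc (L.tensor (L.id n) (L.inl m k)) (L.tensor (L.id n) (L.inr m k)) =
      (L.inclIso (Aleph.distrib n m k)).hom := by
  rw [Law.inl, Law.inr, ← L.incl_id, L.tensor_incl, L.tensor_incl]
  refine (L.desc_uniq _ _ (L.incl (Aleph.distrib n m k)) ?_ ?_).symm <;>
  · rw [← L.incl_comp]
    congr 1
    funext i
    simp [Aleph.tensor, Aleph.distrib, -finSumFinEquiv_apply_left, -finSumFinEquiv_apply_right]
    rfl

theorem pentagon (a b c d : ℕ) :
    L.comp (L.tensor (L.incl (Aleph.assoc a b c).symm) (L.id d))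
      (L.comp (L.incl (Aleph.assoc a (b * c) d).symm)
        (L.tensor (L.id a) (L.incl (Aleph.assoc b c d).symm))) =
    L.comp (L.incl (Aleph.assoc (a * b) c d).symm) (L.incl (Aleph.assoc a b (c * d)).symm) := by
  rw [← L.incl_id, ← L.incl_id, L.tensor_incl, L.tensor_incl, ← L.incl_comp, ← L.incl_comp,
    ← L.incl_comp]
  congr 1
  funext i
  simp [Aleph.tensor, Aleph.assoc]

theorem triangle (a b : ℕ) :
    L.comp (L.incl (Aleph.assoc a 1 b).symm) (L.tensor (L.id a) (L.incl (Aleph.leftUnitor b))) =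
      L.tensor (L.incl (Aleph.rightUnitor a)) (L.id b) := by
  rw [← L.incl_id, ← L.incl_id, L.tensor_incl, L.tensor_incl, ← L.incl_comp]
  congr 1
  funext i
  simp [Aleph.tensor, Aleph.assoc, Aleph.leftUnitor, Aleph.rightUnitor]

theorem hexagon (a b c : ℕ) :
    L.comp (L.incl (Aleph.assoc a b c).symm)
      (L.comp (L.incl (Aleph.braid a (b * c))) (L.incl (Aleph.assoc b c a).symm)) =
    L.comp (L.tensor (L.incl (Aleph.braid a b)) (L.id c))
      (L.comp (L.incl (Aleph.assoc b a c).symm)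
        (L.tensor (L.id b) (L.incl (Aleph.braid a c)))) := by
  rw [← L.incl_id, ← L.incl_id, L.tensor_incl, L.tensor_incl, ← L.incl_comp, ← L.incl_comp,
    ← L.incl_comp, ← L.incl_comp]
  congr 1
  funext i
  simp [Aleph.tensor, Aleph.assoc, Aleph.braid]

theorem hexagon' (a b c : ℕ) :
    L.comp (L.incl (Aleph.assoc a b c))
      (L.comp (L.incl (Aleph.braid (a * b) c)) (L.incl (Aleph.assoc c a b))) =
    L.comp (L.tensor (L.id a) (L.incl (Aleph.braid b c)))
      (L.comp (L.incl (Aleph.assoc a c b))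
        (L.tensor (L.incl (Aleph.braid a c)) (L.id b))) := by
  rw [← L.incl_id, ← L.incl_id, L.tensor_incl, L.tensor_incl, ← L.incl_comp, ← L.incl_comp,
    ← L.incl_comp, ← L.incl_comp]
  congr 1
  funext i
  simp [Aleph.tensor, Aleph.assoc, Aleph.braid]

instance instMonoidal : MonoidalCategory L.Obj :=
  letI : MonoidalCategoryStruct L.Obj :=
    { tensorObj := fun n m => Nat.mul n m
      tensorUnit := (1 : ℕ)
      tensorHom := fun f g => L.tensor f g
      whiskerLeft := fun n _ _ g => L.tensor (L.id n) g
      whiskerRight := fun f m => L.tensor f (L.id m)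
      associator := fun n m k => (L.inclIso (Aleph.assoc n m k)).symm
      leftUnitor := fun n => L.inclIso (Aleph.leftUnitor n)
      rightUnitor := fun n => L.inclIso (Aleph.rightUnitor n) }
  MonoidalCategory.ofTensorHom
    (id_tensorHom_id := fun n m => L.tensor_id n m)
    (id_tensorHom := fun _ _ _ _ => rfl)
    (tensorHom_id := fun _ _ => rfl)
    (tensorHom_comp_tensorHom := fun f g f' g' => (L.tensor_comp f g f' g').symm)
    (associator_naturality := fun {n m k n' m' k'} f g h =>
      (Iso.comp_inv_eq (L.inclIso (Aleph.assoc n' m' k'))).2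
        (((Iso.inv_comp_eq (L.inclIso (Aleph.assoc n m k))).2
          (L.assoc_natural f g h)).symm.trans (Category.assoc _ _ _).symm))
    (leftUnitor_naturality := fun f => L.leftUnitor_natural f)
    (rightUnitor_naturality := fun f => L.rightUnitor_natural f)
    (pentagon := fun a b c d => L.pentagon a b c d)
    (triangle := fun a b => L.triangle a b)

instance instSymmetric : SymmetricCategory L.Obj where
  braiding n m := L.inclIso (Aleph.braid n m)
  braiding_naturality_right n _ _ f := L.braid_natural (L.id n) f
  braiding_naturality_left f m := L.braid_natural f (L.id m)
  hexagon_forward a b c := L.hexagon a b c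
  hexagon_reverse a b c := L.hexagon' a b c
  symmetry n m := (L.inclIso (Aleph.braid n m)).hom_inv_id

end SMLaw

/-! ### The commutative semiring of scalars `L(1, 1)` -/

namespace SMBLaw

variable (L : SMBLaw.{u})

/-- The zero map `n → 0 → m`. -/
def zero (n m : ℕ) : L.Hom n m := L.comp (L.toZero n) (L.fromZero m)

/-- The biproduct `f ⊕ g` of two maps. -/
def oplus {n m p q : ℕ} (f : L.Hom n p) (g : L.Hom m q) : L.Hom (n + m) (p + q) :=
  L.desc (L.comp f (L.inl p q)) (L.comp g (L.inr p q))

/-- The sum of two parallel maps: `n → n ⊕ n → m ⊕ m → m`, that is `∇ ∘ (f ⊕ g) ∘ Δ`. -/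
def add {n m : ℕ} (f g : L.Hom n m) : L.Hom n m :=
  L.comp (L.lift (L.id n) (L.id n)) (L.comp (L.oplus f g) (L.desc (L.id m) (L.id m)))

variable {L}

theorem zero_comp {n m p : ℕ} (f : L.Hom m p) : L.comp (L.zero n m) f = L.zero n p := by
  rw [zero, L.comp_assoc]; exact congrArg _ (L.initial_uniq _ _)

theorem comp_zero {n m p : ℕ} (f : L.Hom n m) : L.comp f (L.zero m p) = L.zero n p := by
  rw [zero, ← L.comp_assoc, L.terminal_uniq (L.comp f _) (L.toZero n)]; rfl

theorem desc_comp {n m p q : ℕ} (f : L.Hom n p) (g : L.Hom m p) (h : L.Hom p q) :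
    L.comp (L.desc f g) h = L.desc (L.comp f h) (L.comp g h) :=
  L.desc_uniq _ _ _ (by rw [← L.comp_assoc, L.inl_desc]) (by rw [← L.comp_assoc, L.inr_desc])

theorem comp_lift {n m p q : ℕ} (f : L.Hom p n) (g : L.Hom p m) (h : L.Hom q p) :
    L.comp h (L.lift f g) = L.lift (L.comp h f) (L.comp h g) :=
  L.lift_uniq _ _ _ (by rw [L.comp_assoc, L.lift_fst]) (by rw [L.comp_assoc, L.lift_snd])

theorem oplus_desc {n m p q r : ℕ} (f : L.Hom n p) (g : L.Hom m q) (h : L.Hom p r)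
    (k : L.Hom q r) : L.comp (L.oplus f g) (L.desc h k) = L.desc (L.comp f h) (L.comp g k) := by
  rw [oplus, desc_comp, L.comp_assoc, L.comp_assoc, Law.inl, Law.inr, L.inl_desc, L.inr_desc]

theorem oplus_fst {n m p q : ℕ} (f : L.Hom n p) (g : L.Hom m q) :
    L.comp (L.oplus f g) (L.fst p q) = L.comp (L.fst n m) f := by
  have h2 := L.desc_uniq f (L.zero m p) (L.comp (L.fst n m) f)
    (by rw [← L.comp_assoc]; exact (congrArg (L.comp · f) (L.inl_fst n m)).trans (L.id_comp f))
    (by rw [← L.comp_assoc]; exact (congrArg (L.comp · f) (L.inr_fst n m)).trans (zero_comp f))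
  rw [h2, oplus, desc_comp, L.comp_assoc, L.comp_assoc, L.inl_fst, L.inr_fst, L.comp_id]
  exact congrArg _ (comp_zero g)

theorem oplus_snd {n m p q : ℕ} (f : L.Hom n p) (g : L.Hom m q) :
    L.comp (L.oplus f g) (L.snd p q) = L.comp (L.snd n m) g := by
  have h2 := L.desc_uniq (L.zero n q) g (L.comp (L.snd n m) g)
    (by rw [← L.comp_assoc]; exact (congrArg (L.comp · g) (L.inl_snd n m)).trans (zero_comp g))
    (by rw [← L.comp_assoc]; exact (congrArg (L.comp · g) (L.inr_snd n m)).trans (L.id_comp g))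
  rw [h2, oplus, desc_comp, L.comp_assoc, L.comp_assoc, L.inl_snd, L.inr_snd, L.comp_id]
  exact congrArg (L.desc · g) (comp_zero f)

theorem lift_oplus {n m p q r : ℕ} (h : L.Hom r n) (k : L.Hom r m) (f : L.Hom n p)
    (g : L.Hom m q) : L.comp (L.lift h k) (L.oplus f g) = L.lift (L.comp h f) (L.comp k g) :=
  L.lift_uniq _ _ _
    (by rw [L.comp_assoc, oplus_fst, ← L.comp_assoc, L.lift_fst])
    (by rw [L.comp_assoc, oplus_snd, ← L.comp_assoc, L.lift_snd])

theorem add_eq_desc {n m : ℕ} (f g : L.Hom n m) :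
    L.add f g = L.comp (L.lift (L.id n) (L.id n)) (L.desc f g) := by
  rw [add, oplus_desc, L.comp_id, L.comp_id]

theorem add_eq_lift {n m : ℕ} (f g : L.Hom n m) :
    L.add f g = L.comp (L.lift f g) (L.desc (L.id m) (L.id m)) := by
  rw [add, ← L.comp_assoc, lift_oplus, L.id_comp, L.id_comp]

theorem add_comp {n m p : ℕ} (f g : L.Hom n m) (h : L.Hom m p) :
    L.comp (L.add f g) h = L.add (L.comp f h) (L.comp g h) := by
  rw [add_eq_desc, add_eq_desc, L.comp_assoc, desc_comp]

theorem comp_add {n m p : ℕ} (h : L.Hom n m) (f g : L.Hom m p) :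
    L.comp h (L.add f g) = L.add (L.comp h f) (L.comp h g) := by
  rw [add_eq_lift, add_eq_lift, ← L.comp_assoc, comp_lift]

theorem add_zero {n m : ℕ} (f : L.Hom n m) : L.add f (L.zero n m) = f := by
  have h : L.desc f (L.zero n m) = L.comp (L.fst n n) f := (L.desc_uniq _ _ _
    (by rw [← L.comp_assoc]; exact (congrArg (L.comp · f) (L.inl_fst n n)).trans (L.id_comp f))
    (by rw [← L.comp_assoc];
        exact (congrArg (L.comp · f) (L.inr_fst n n)).trans (zero_comp f))).symm
  rw [add_eq_desc, h, ← L.comp_assoc, L.lift_fst, L.id_comp]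

theorem zero_add {n m : ℕ} (f : L.Hom n m) : L.add (L.zero n m) f = f := by
  have h : L.desc (L.zero n m) f = L.comp (L.snd n n) f := (L.desc_uniq _ _ _
    (by rw [← L.comp_assoc]; exact (congrArg (L.comp · f) (L.inl_snd n n)).trans (zero_comp f))
    (by rw [← L.comp_assoc];
        exact (congrArg (L.comp · f) (L.inr_snd n n)).trans (L.id_comp f))).symm
  rw [add_eq_desc, h, ← L.comp_assoc, L.lift_snd, L.id_comp]

theorem add_add_add {n m : ℕ} (a b c d : L.Hom n m) :
    L.add (L.add a b) (L.add c d) = L.add (L.add a c) (L.add b d) := by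
  have e : ∀ x y z w : L.Hom n m, L.lift (L.desc x y) (L.desc z w) =
      L.desc (L.lift x z) (L.lift y w) := fun x y z w =>
    L.desc_uniq _ _ _ (by rw [comp_lift, L.inl_desc, L.inl_desc])
      (by rw [comp_lift, L.inr_desc, L.inr_desc])
  rw [add_eq_lift (L.add a b), add_eq_desc a b, add_eq_desc c d, ← comp_lift, e, L.comp_assoc,
    desc_comp, ← add_eq_lift, ← add_eq_lift, ← add_eq_desc]

theorem add_comm {n m : ℕ} (f g : L.Hom n m) : L.add f g = L.add g f := by
  have := add_add_add (L.zero n m) f g (L.zero n m)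
  rwa [zero_add, add_zero, zero_add, add_zero] at this

theorem add_assoc {n m : ℕ} (f g h : L.Hom n m) :
    L.add (L.add f g) h = L.add f (L.add g h) := by
  have := add_add_add f g (L.zero n m) h
  rwa [zero_add, add_zero] at this

theorem comp_comm_one (s t : L.Hom 1 1) : L.comp s t = L.comp t s := by
  have hu : L.incl (Aleph.rightUnitor 1) = L.incl (Aleph.leftUnitor 1) :=
    congrArg _ (funext fun _ => Subsingleton.elim _ _)
  have key : ∀ s t : L.Hom 1 1, L.comp (L.tensor s t) (L.incl (Aleph.leftUnitor 1)) =
      L.comp (L.incl (Aleph.leftUnitor 1)) (L.comp s t) := fun s t => by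
    have : L.tensor s t = L.comp (L.tensor s (L.id 1)) (L.tensor (L.id 1) t) := by
      rw [← L.tensor_comp, L.comp_id, L.id_comp]
    rw [this, L.comp_assoc, L.leftUnitor_natural, ← L.comp_assoc, ← hu, L.rightUnitor_natural,
      L.comp_assoc]
  have key' : ∀ s t : L.Hom 1 1, L.comp (L.tensor s t) (L.incl (Aleph.leftUnitor 1)) =
      L.comp (L.incl (Aleph.leftUnitor 1)) (L.comp t s) := fun s t => by
    have : L.tensor s t = L.comp (L.tensor (L.id 1) t) (L.tensor s (L.id 1)) := by
      rw [← L.tensor_comp, L.comp_id, L.id_comp]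
    rw [this, ← hu, L.comp_assoc, L.rightUnitor_natural, ← L.comp_assoc, hu, L.leftUnitor_natural,
      L.comp_assoc]
  have h := (key s t).symm.trans (key' s t)
  have hinv : L.comp (L.incl (Aleph.leftUnitor 1).symm) (L.incl (Aleph.leftUnitor 1)) = L.id 1 :=
    (L.inclIso (Aleph.leftUnitor 1)).inv_hom_id
  have h2 := congrArg (L.comp (L.incl (Aleph.leftUnitor 1).symm)) h
  rw [← L.comp_assoc, hinv, L.id_comp, ← L.comp_assoc, hinv, L.id_comp] at h2
  exact h2

variable (L)

/-- The set `L(1, 1)` of endomaps of the tensor unit. -/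
def Scalars : Type u := L.Hom 1 1

instance : Zero L.Scalars := ⟨L.zero 1 1⟩

instance : Add L.Scalars := ⟨L.add (n := 1) (m := 1)⟩

/-- `L(1, 1)` is a commutative semiring, with addition from the biproducts and with composition as
multiplication. -/
instance : CommSemiring L.Scalars where
  mul := L.comp (n := 1) (m := 1) (p := 1)
  one := L.id 1
  add_assoc := add_assoc
  zero_add := zero_add
  add_zero := add_zero
  add_comm := add_comm
  nsmul := nsmulRec
  left_distrib := comp_add
  right_distrib := add_comp
  zero_mul := zero_comp
  mul_zero := comp_zero
  mul_assoc := L.comp_assoc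
  one_mul := L.id_comp
  mul_one := L.comp_id
  mul_comm := comp_comm_one

/-! ### The category `SMBLaw` -/

/-- A morphism of symmetric monoidal Lawvere theories with biproducts: a functor that is the
identity on objects and strictly preserves the finite coproducts (equivalently, commutes with the
functors from `ℵ₀`), the tensor and the biproduct projections. -/
@[ext]
structure Morphism (L K : SMBLaw.{u}) where
  map : ∀ {n m : ℕ}, L.Hom n m → K.Hom n m
  map_id : ∀ n, map (L.id n) = K.id n
  map_comp : ∀ {n m p} (f : L.Hom n m) (g : L.Hom m p), map (L.comp f g) = K.comp (map f) (map g)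
  map_incl : ∀ {n m} (f : Fin n → Fin m), map (L.incl f) = K.incl f
  map_tensor : ∀ {n m p q} (f : L.Hom n p) (g : L.Hom m q),
    map (L.tensor f g) = K.tensor (map f) (map g)
  map_fst : ∀ n m, map (L.fst n m) = K.fst n m
  map_snd : ∀ n m, map (L.snd n m) = K.snd n m

instance : Category SMBLaw.{u} where
  Hom L K := Morphism L K
  id L := ⟨fun f => f, fun _ => rfl, fun _ _ => rfl, fun _ => rfl, fun _ _ => rfl, fun _ _ => rfl,
    fun _ _ => rfl⟩
  comp F G :=
    { map := fun f => G.map (F.map f)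
      map_id := fun n => by rw [F.map_id, G.map_id]
      map_comp := fun f g => by rw [F.map_comp, G.map_comp]
      map_incl := fun f => by rw [F.map_incl, G.map_incl]
      map_tensor := fun f g => by rw [F.map_tensor, G.map_tensor]
      map_fst := fun n m => by rw [F.map_fst, G.map_fst]
      map_snd := fun n m => by rw [F.map_snd, G.map_snd] }

variable {L}

theorem map_add {K : SMBLaw.{u}} (F : Morphism L K) {n m : ℕ} (f g : L.Hom n m) :
    F.map (L.add f g) = K.add (F.map f) (F.map g) := by
  rw [add_eq_lift, add_eq_lift, F.map_comp]
  congr 1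
  · exact K.lift_uniq _ _ _ (by rw [← F.map_fst, ← F.map_comp, L.lift_fst])
      (by rw [← F.map_snd, ← F.map_comp, L.lift_snd])
  · exact K.desc_uniq _ _ _
      (by rw [← F.map_incl, ← F.map_comp, L.inl_desc, F.map_id])
      (by rw [← F.map_incl, ← F.map_comp, L.inr_desc, F.map_id])

theorem map_zero {K : SMBLaw.{u}} (F : Morphism L K) (n m : ℕ) :
    F.map (L.zero n m) = K.zero n m := by
  rw [zero, F.map_comp, K.terminal_uniq (F.map _) (K.toZero n),
    K.initial_uniq (F.map _) (K.fromZero m)]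
  rfl

/-- The restriction of a morphism of theories to scalars. -/
def scalarsMap {K : SMBLaw.{u}} (F : L ⟶ K) : L.Scalars →+* K.Scalars where
  toFun := Morphism.map F (n := 1) (m := 1)
  map_one' := Morphism.map_id F 1
  map_mul' := Morphism.map_comp F (n := 1) (m := 1) (p := 1)
  map_zero' := map_zero F 1 1
  map_add' := map_add F (n := 1) (m := 1)

end SMBLaw

/-- The functor `H : SMBLaw ⥤ CSRng`, `L ↦ L(1, 1)`. -/
def scalarsFunctor : SMBLaw.{u} ⥤ CommSemiRingCat.{u} where
  obj L := CommSemiRingCat.of L.Scalars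
  map F := CommSemiRingCat.ofHom (SMBLaw.scalarsMap F)

/-! ### The Lawvere theory of matrices over a commutative semiring -/

namespace Mat

open scoped Kronecker

variable {S : Type u} [CommSemiring S]

/-- The matrix of a function between finite ordinals. -/
def incl {n m : ℕ} (f : Fin n → Fin m) : Matrix (Fin n) (Fin m) S :=
  Matrix.of fun i j => if f i = j then 1 else 0

/-- Composition of `g : n → m` and `h : m → p`: the matrix product
`(i, k) ↦ ∑ j, g i j * h j k`. -/
def comp {n m p : ℕ} (g : Matrix (Fin n) (Fin m) S) (h : Matrix (Fin m) (Fin p) S) :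
    Matrix (Fin n) (Fin p) S := g * h

/-- The tensor `(g ⊗ h)((i₀, i₁), (j₀, j₁)) = g(i₀, j₀) * h(i₁, j₁)`. -/
def tensor {n m p q : ℕ} (g : Matrix (Fin n) (Fin p) S) (h : Matrix (Fin m) (Fin q) S) :
    Matrix (Fin (n * m)) (Fin (p * q)) S :=
  (g ⊗ₖ h).submatrix finProdFinEquiv.symm finProdFinEquiv.symm

/-- The cotuple of two matrices: one on top of the other. -/
def desc {n m p : ℕ} (f : Matrix (Fin n) (Fin p) S) (g : Matrix (Fin m) (Fin p) S) :
    Matrix (Fin (n + m)) (Fin p) S :=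
  Matrix.of fun i j => Fin.addCases (fun i => f i j) (fun i => g i j) i

/-- The tuple of two matrices: one next to the other. -/
def lift {n m p : ℕ} (f : Matrix (Fin p) (Fin n) S) (g : Matrix (Fin p) (Fin m) S) :
    Matrix (Fin p) (Fin (n + m)) S :=
  Matrix.of fun i j => Fin.addCases (fun j => f i j) (fun j => g i j) j

variable (S) in
/-- The projection `π₁ : n + m → n`. -/
def fst (n m : ℕ) : Matrix (Fin (n + m)) (Fin n) S :=
  Matrix.of fun i j => if i = Fin.castAdd m j then 1 else 0

variable (S) in
/-- The projection `π₂ : n + m → m`. -/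
def snd (n m : ℕ) : Matrix (Fin (n + m)) (Fin m) S :=
  Matrix.of fun i j => if i = Fin.natAdd n j then 1 else 0

theorem incl_comp {n m p : ℕ} (f : Fin n → Fin m) (A : Matrix (Fin m) (Fin p) S) :
    comp (incl f) A = A.submatrix f id := by
  ext i j
  rw [comp, Matrix.mul_apply]
  simp [incl]

theorem comp_incl {n m p : ℕ} (A : Matrix (Fin n) (Fin m) S) (e : Fin m ≃ Fin p) :
    comp A (incl e) = A.submatrix id e.symm := by
  ext i j
  rw [comp, Matrix.mul_apply]
  simp [incl, ← Equiv.eq_symm_apply]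

theorem comp_fst {n m p : ℕ} (A : Matrix (Fin p) (Fin (n + m)) S) :
    comp A (fst S n m) = A.submatrix id (Fin.castAdd m) := by
  ext i j
  rw [comp, Matrix.mul_apply]
  simp [fst]

theorem comp_snd {n m p : ℕ} (A : Matrix (Fin p) (Fin (n + m)) S) :
    comp A (snd S n m) = A.submatrix id (Fin.natAdd n) := by
  ext i j
  rw [comp, Matrix.mul_apply]
  simp [snd]

theorem tensor_apply {n m p q : ℕ} (g : Matrix (Fin n) (Fin p) S) (h : Matrix (Fin m) (Fin q) S)
    (a : Fin n) (b : Fin m) (c : Fin p) (d : Fin q) :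
    tensor g h (finProdFinEquiv (a, b)) (finProdFinEquiv (c, d)) = g a c * h b d := by
  simp [tensor, - finProdFinEquiv_symm_apply]

theorem tensor_ext {R : Type u} {n m p q : ℕ} {A B : Matrix (Fin (n * m)) (Fin (p * q)) R}
    (h : ∀ a b c d, A (finProdFinEquiv (a, b)) (finProdFinEquiv (c, d)) =
      B (finProdFinEquiv (a, b)) (finProdFinEquiv (c, d))) : A = B := by
  ext i j
  obtain ⟨⟨a, b⟩, rfl⟩ := finProdFinEquiv.surjective i
  obtain ⟨⟨c, d⟩, rfl⟩ := finProdFinEquiv.surjective j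
  exact h a b c d

theorem incl_of_comp {n m p : ℕ} (f : Fin n → Fin m) (g : Fin m → Fin p) :
    (incl (fun i => g (f i)) : Matrix _ _ S) = comp (incl f) (incl g) := by
  rw [incl_comp]; rfl

theorem desc_ext {n m p : ℕ} {f : Matrix (Fin n) (Fin p) S} {g : Matrix (Fin m) (Fin p) S}
    {h : Matrix (Fin (n + m)) (Fin p) S} (hf : comp (incl (Fin.castAdd m)) h = f)
    (hg : comp (incl (Fin.natAdd n)) h = g) : h = desc f g := by
  subst hf hg
  ext i j
  rw [incl_comp, incl_comp]
  refine Fin.addCases (fun i => ?_) (fun i => ?_) i <;> simp [desc]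

theorem lift_ext {n m p : ℕ} {f : Matrix (Fin p) (Fin n) S} {g : Matrix (Fin p) (Fin m) S}
    {h : Matrix (Fin p) (Fin (n + m)) S} (hf : comp h (fst S n m) = f)
    (hg : comp h (snd S n m) = g) : h = lift f g := by
  subst hf hg
  ext i j
  rw [comp_fst, comp_snd]
  refine Fin.addCases (fun j => ?_) (fun j => ?_) j <;> simp [lift]

theorem tensor_comp {n m p q r s : ℕ} (f : Matrix (Fin n) (Fin p) S) (g : Matrix (Fin m) (Fin q) S)
    (f' : Matrix (Fin p) (Fin r) S) (g' : Matrix (Fin q) (Fin s) S) :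
    tensor (comp f f') (comp g g') = comp (tensor f g) (tensor f' g') := by
  simp only [tensor, comp]
  rw [Matrix.mul_kronecker_mul, Matrix.submatrix_mul_equiv]

theorem tensor_one (n m : ℕ) :
    tensor (1 : Matrix (Fin n) (Fin n) S) (1 : Matrix (Fin m) (Fin m) S) = 1 := by
  simp [tensor]

theorem tensor_incl {n m p q : ℕ} (f : Fin n → Fin p) (g : Fin m → Fin q) :
    (tensor (incl f) (incl g) : Matrix _ _ S) = incl (Aleph.tensor f g) := by
  refine tensor_ext fun a b c d => ?_
  rw [tensor_apply]
  simp only [incl, Aleph.tensor, Matrix.of_apply, Equiv.symm_apply_apply,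
    EmbeddingLike.apply_eq_iff_eq, Prod.map_apply, Prod.mk.injEq]
  split_ifs <;> simp_all

theorem assoc_natural {n m k n' m' k' : ℕ} (f : Matrix (Fin n) (Fin n') S)
    (g : Matrix (Fin m) (Fin m') S) (h : Matrix (Fin k) (Fin k') S) :
    comp (tensor f (tensor g h)) (incl (Aleph.assoc n' m' k')) =
      comp (incl (Aleph.assoc n m k)) (tensor (tensor f g) h) := by
  rw [comp_incl, incl_comp]
  ext i j
  simp [tensor, Aleph.assoc, mul_assoc]

theorem leftUnitor_natural {n m : ℕ} (f : Matrix (Fin n) (Fin m) S) :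
    comp (tensor 1 f) (incl (Aleph.leftUnitor m)) = comp (incl (Aleph.leftUnitor n)) f := by
  rw [comp_incl, incl_comp]
  ext i j
  obtain ⟨⟨a, b⟩, rfl⟩ := finProdFinEquiv.surjective i
  have : (Aleph.leftUnitor m).symm j = finProdFinEquiv (0, j) := rfl
  rw [Matrix.submatrix_apply, Matrix.submatrix_apply, this, id, id, tensor_apply,
    Subsingleton.elim a 0, Matrix.one_apply_eq, one_mul]
  simp [Aleph.leftUnitor, - finProdFinEquiv_symm_apply]

theorem rightUnitor_natural {n m : ℕ} (f : Matrix (Fin n) (Fin m) S) :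
    comp (tensor f 1) (incl (Aleph.rightUnitor m)) = comp (incl (Aleph.rightUnitor n)) f := by
  rw [comp_incl, incl_comp]
  ext i j
  obtain ⟨⟨a, b⟩, rfl⟩ := finProdFinEquiv.surjective i
  have : (Aleph.rightUnitor m).symm j = finProdFinEquiv (j, 0) := rfl
  rw [Matrix.submatrix_apply, Matrix.submatrix_apply, this, id, id, tensor_apply,
    Subsingleton.elim b 0, Matrix.one_apply_eq, mul_one]
  simp [Aleph.rightUnitor, - finProdFinEquiv_symm_apply]

theorem braid_natural {n m n' m' : ℕ} (f : Matrix (Fin n) (Fin n') S)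
    (g : Matrix (Fin m) (Fin m') S) :
    comp (tensor f g) (incl (Aleph.braid n' m')) = comp (incl (Aleph.braid n m)) (tensor g f) := by
  rw [comp_incl, incl_comp]
  ext i j
  simp [tensor, Aleph.braid, mul_comm]

variable (S)

/-- The Lawvere theory `Mat(S)`: maps `n → m` are `n × m` matrices over `S`. -/
def theory : SMBLaw.{u} where
  Hom n m := Matrix (Fin n) (Fin m) S
  id _ := 1
  comp := comp
  id_comp f := Matrix.one_mul f
  comp_id f := Matrix.mul_one f
  comp_assoc f g h := Matrix.mul_assoc f g h
  incl := incl
  incl_id n := by ext i j; simp [incl, Matrix.one_apply]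
  incl_comp := incl_of_comp
  initial_uniq f g := by ext i; exact i.elim0
  desc := desc
  inl_desc f g := by rw [incl_comp]; ext i j; simp [desc]
  inr_desc f g := by rw [incl_comp]; ext i j; simp [desc]
  desc_uniq _ _ _ := desc_ext
  tensor := tensor
  tensor_id := tensor_one
  tensor_comp := tensor_comp
  tensor_incl := tensor_incl
  assoc_natural := assoc_natural
  leftUnitor_natural := leftUnitor_natural
  rightUnitor_natural := rightUnitor_natural
  braid_natural := braid_natural
  toZero n := 0
  terminal_uniq f g := by ext i j; exact j.elim0
  fst := fst S
  snd := snd S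
  inl_fst n m := (incl_comp _ _).trans <| by
    ext i j
    simp [fst, Matrix.one_apply]
  inr_fst n m := (incl_comp _ _).trans <| by
    ext i j
    rw [comp, Matrix.zero_mul]
    simp [fst, Fin.ext_iff]
    omega
  inl_snd n m := (incl_comp _ _).trans <| by
    ext i j
    rw [comp, Matrix.zero_mul]
    simp [snd, Fin.ext_iff]
    omega
  inr_snd n m := (incl_comp _ _).trans <| by
    ext i j
    simp [snd, Matrix.one_apply]
  lift := lift
  lift_fst f g := by rw [comp_fst]; ext i j; simp [lift]
  lift_snd f g := by rw [comp_snd]; ext i j; simp [lift]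
  lift_uniq _ _ _ := lift_ext

variable {S}

theorem map_comp {R : Type u} [CommSemiring R] (f : S →+* R) {n m p : ℕ}
    (g : Matrix (Fin n) (Fin m) S) (h : Matrix (Fin m) (Fin p) S) :
    (comp g h).map f = comp (g.map f) (h.map f) := Matrix.map_mul

theorem map_tensor {R : Type u} [CommSemiring R] (f : S →+* R) {n m p q : ℕ}
    (g : Matrix (Fin n) (Fin p) S) (h : Matrix (Fin m) (Fin q) S) :
    (tensor g h).map f = tensor (g.map f) (h.map f) :=
  tensor_ext fun a b c d => by simp only [Matrix.map_apply, tensor_apply, map_mul]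

/-- A homomorphism of semirings acts on matrices entrywise. -/
def theoryMap {R : Type u} [CommSemiring R] (f : S →+* R) : theory S ⟶ theory R where
  map {n m} (h : Matrix (Fin n) (Fin m) S) := h.map f
  map_id n := Matrix.map_one f (map_zero f) (map_one f)
  map_comp g h := map_comp f g h
  map_incl g := Matrix.ext fun i j => by simp [theory, incl, apply_ite f]
  map_tensor g h := map_tensor f g h
  map_fst n m := Matrix.ext fun i j => by simp [theory, fst, apply_ite f]
  map_snd n m := Matrix.ext fun i j => by simp [theory, snd, apply_ite f]

/-- The endomap of `1` in `Mat(S)` given by an element of `S`. -/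
def scalar (s : S) : (theory S).Hom 1 1 := (Matrix.of fun _ _ => s : Matrix (Fin 1) (Fin 1) S)

end Mat

/-- The functor `Mat : CSRng ⥤ SMBLaw`. -/
def matFunctor : CommSemiRingCat.{u} ⥤ SMBLaw.{u} where
  obj S := Mat.theory S
  map f := Mat.theoryMap f.hom

/-! ### Involutive commutative semirings -/

/-- An involution on a commutative semiring. -/
structure IsInvolution {R : Type u} [CommSemiring R] (inv : R → R) : Prop where
  map_add : ∀ s t, inv (s + t) = inv s + inv t
  map_zero : inv 0 = 0
  map_mul : ∀ s t, inv (s * t) = inv s * inv t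
  map_one : inv 1 = 1
  inv_inv : ∀ s, inv (inv s) = s

/-- An involutive commutative semiring. -/
structure ICSRng where
  carrier : Type u
  [commSemiring : CommSemiring carrier]
  inv : carrier → carrier
  isInvolution : IsInvolution inv

namespace ICSRng

instance : CoeSort ICSRng.{u} (Type u) := ⟨carrier⟩

instance (S : ICSRng.{u}) : CommSemiring S := S.commSemiring

/-- The involution as a Mathlib star ring structure (as the semiring is commutative, it does not
matter whether the star preserves or reverses products). -/
instance (S : ICSRng.{u}) : StarRing S where
  star := S.inv
  star_involutive := S.isInvolution.inv_inv
  star_mul s t := (S.isInvolution.map_mul s t).trans (mul_comm _ _)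
  star_add := S.isInvolution.map_add

/-- A homomorphism of semirings that preserves the involution. -/
@[ext]
structure Morphism (S R : ICSRng.{u}) where
  hom : S →+* R
  map_inv : ∀ s, hom (S.inv s) = R.inv (hom s)

instance : Category ICSRng.{u} where
  Hom S R := Morphism S R
  id S := ⟨RingHom.id S, fun _ => rfl⟩
  comp f g := ⟨g.hom.comp f.hom, fun s => by simp [f.map_inv, g.map_inv]⟩

end ICSRng

/-- The functor that forgets the involution. -/
def forgetInv : ICSRng.{u} ⥤ CommSemiRingCat.{u} where
  obj S := CommSemiRingCat.of S
  map f := CommSemiRingCat.ofHom f.hom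

/-! ### Dagger symmetric monoidal Lawvere theories with dagger biproducts -/

/-- The family of maps `dag` is a dagger on `L`, that is, a contravariant involutive functor that is
the identity on objects, it preserves the tensor, the coherence isomorphisms are dagger isomorphisms
(their dagger is their inverse), and `κ₁ = π₁†`, `κ₂ = π₂†`. -/
structure SMBLaw.IsDagger (L : SMBLaw.{u}) (dag : ∀ {n m : ℕ}, L.Hom n m → L.Hom m n) : Prop where
  dag_id : ∀ n, dag (L.id n) = L.id n
  dag_comp : ∀ {n m p} (f : L.Hom n m) (g : L.Hom m p), dag (L.comp f g) = L.comp (dag g) (dag f)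
  dag_dag : ∀ {n m} (f : L.Hom n m), dag (dag f) = f
  dag_tensor : ∀ {n m p q} (f : L.Hom n p) (g : L.Hom m q),
    dag (L.tensor f g) = L.tensor (dag f) (dag g)
  dag_assoc : ∀ n m k, dag (L.incl (Aleph.assoc n m k)) = L.incl (Aleph.assoc n m k).symm
  dag_leftUnitor : ∀ n, dag (L.incl (Aleph.leftUnitor n)) = L.incl (Aleph.leftUnitor n).symm
  dag_rightUnitor : ∀ n, dag (L.incl (Aleph.rightUnitor n)) = L.incl (Aleph.rightUnitor n).symm
  dag_braid : ∀ n m, dag (L.incl (Aleph.braid n m)) = L.incl (Aleph.braid n m).symm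
  dag_fst : ∀ n m, dag (L.fst n m) = L.inl n m
  dag_snd : ∀ n m, dag (L.snd n m) = L.inr n m

/-- A dagger symmetric monoidal Lawvere theory with dagger biproducts. -/
structure DSMBLaw extends SMBLaw.{u} where
  dag : ∀ {n m : ℕ}, Hom n m → Hom m n
  isDagger : toSMBLaw.IsDagger dag

namespace DSMBLaw

/-- A morphism of the underlying theories that strictly commutes with the daggers. -/
@[ext]
structure Morphism (L K : DSMBLaw.{u}) where
  hom : L.toSMBLaw ⟶ K.toSMBLaw
  map_dag : ∀ {n m : ℕ} (f : L.Hom n m),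
    SMBLaw.Morphism.map hom (L.dag f) = K.dag (SMBLaw.Morphism.map hom f)

instance : Category DSMBLaw.{u} where
  Hom L K := Morphism L K
  id L := ⟨𝟙 L.toSMBLaw, fun _ => rfl⟩
  comp F G := ⟨F.hom ≫ G.hom, fun f =>
    (congrArg (SMBLaw.Morphism.map G.hom) (F.map_dag f)).trans (G.map_dag _)⟩

/-- The map `s ↦ s†` on the scalars. -/
def scalarsInv (L : DSMBLaw.{u}) : L.Scalars → L.Scalars := L.dag (n := 1) (m := 1)

end DSMBLaw

/-- The functor that forgets the dagger. -/
def forgetDagger : DSMBLaw.{u} ⥤ SMBLaw.{u} where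
  obj L := L.toSMBLaw
  map F := F.hom

/-! ### The candidates for the restrictions of `Mat` and `H` -/

/-- Conjugate transposition of the maps of `Mat(S)`: `f† i j = (f j i)*`. -/
def Mat.conjTranspose (S : ICSRng.{u}) {n m : ℕ} (f : (Mat.theory S).Hom n m) :
    (Mat.theory S).Hom m n := Matrix.conjTranspose (α := S) f

/-- If conjugate transposition is a dagger on every `Mat(S)`, and if every `Mat(f)` commutes with
it, then `Mat` with conjugate transposition is a functor from `ICSRng` to `DSMBLaw`. -/
def matDaggerFunctor
    (hobj : ∀ S : ICSRng.{u}, (Mat.theory S).IsDagger (Mat.conjTranspose S))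
    (hmap : ∀ {S R : ICSRng.{u}} (f : S ⟶ R) {n m : ℕ} (h : (Mat.theory S).Hom n m),
      (Mat.theoryMap f.hom).map (Mat.conjTranspose S h) =
        Mat.conjTranspose R ((Mat.theoryMap f.hom).map h)) :
    ICSRng.{u} ⥤ DSMBLaw.{u} where
  obj S := { toSMBLaw := Mat.theory S, dag := Mat.conjTranspose S, isDagger := hobj S }
  map f := ⟨Mat.theoryMap f.hom, hmap f⟩

/-- If `s ↦ s†` is an involution on every `L(1, 1)`, and if the restriction to scalars of every
morphism of theories with dagger commutes with it, then `H` with these involutions is a functor from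
`DSMBLaw` to `ICSRng`. -/
def scalarsInvFunctor
    (hobj : ∀ L : DSMBLaw.{u}, IsInvolution L.scalarsInv)
    (hmap : ∀ {L K : DSMBLaw.{u}} (F : L ⟶ K) (s : L.Scalars),
      SMBLaw.scalarsMap F.hom (L.scalarsInv s) = K.scalarsInv (SMBLaw.scalarsMap F.hom s)) :
    DSMBLaw.{u} ⥤ ICSRng.{u} where
  obj L := { carrier := L.Scalars, inv := L.scalarsInv, isInvolution := hobj L }
  map F := ⟨SMBLaw.scalarsMap F.hom, hmap F⟩

end LawTheory

open LawTheory

/-! In a theory `L` with biproducts the object `n` is a biproduct of `n` copies of `1`, so a map `f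
: n → m` amounts to its matrix of entries `π_j ∘ f ∘ κ_i` in `L(1, 1)`. The relations `π_j ∘ κ_i =
δ_ij` and `id = ∑ κ_i ∘ π_i` (`inj_comp_proj`, `id_eq_sum`) turn composition into the matrix
product. The tensor becomes the Kronecker product (`entry_tensor`), because the coprojections and
projections of `n * m` are, up to a unitor, tensors of those of `n` and `m`, and because scalars are
tensored by composing them. Hence `L` is isomorphic to `Mat(L(1, 1))`, naturally in `L`
(`entriesIso`).

The inverse of this isomorphism is the counit of the adjunction; the unit sends `s` to the matrix
`(s)`. On `Mat(S)` taking entries is the same as applying the unit entrywise, which is one triangle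
identity; the other says that the endomap of `1` with entry `s` is `s`.

With a dagger, `π_i† = κ_i` forces the entries of `f†` to be the daggers of the transposed entries
of `f` (`dag_entry`). So every dagger is conjugate transposition for the involution `s ↦ s†` on
scalars, and the unit and counit respect the extra structure. The triangle identities carry over,
since morphisms on both sides are determined by the underlying ones. -/

namespace LawTheory

namespace SMBLaw

/-! ### Matrix calculus inside a theory with biproducts. -/

section Entries

variable {L : SMBLaw.{u}}

instance (n m : ℕ) : Zero (L.Hom n m) := ⟨L.zero n m⟩

instance (n m : ℕ) : Add (L.Hom n m) := ⟨L.add⟩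

/-- This makes finite sums of maps available. For `n = m = 1` it agrees by definition with the
additive structure of `L.Scalars`, so sums can be read on either side. -/
instance (n m : ℕ) : AddCommMonoid (L.Hom n m) where
  add_assoc := add_assoc
  zero_add := zero_add
  add_zero := add_zero
  add_comm := add_comm
  nsmul := nsmulRec

theorem sum_comp {ι : Type*} (s : Finset ι) {n m p : ℕ} (f : ι → L.Hom n m) (g : L.Hom m p) :
    L.comp (∑ i ∈ s, f i) g = ∑ i ∈ s, L.comp (f i) g :=
  map_sum (⟨⟨fun f => L.comp f g, zero_comp g⟩, fun a b => add_comp a b g⟩ :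
    L.Hom n m →+ L.Hom n p) f s

theorem comp_sum {ι : Type*} (s : Finset ι) {n m p : ℕ} (f : L.Hom n m) (g : ι → L.Hom m p) :
    L.comp f (∑ i ∈ s, g i) = ∑ i ∈ s, L.comp f (g i) :=
  map_sum (⟨⟨fun g => L.comp f g, comp_zero f⟩, fun a b => comp_add f a b⟩ :
    L.Hom m p →+ L.Hom n p) g s

variable (L) in
/-- The coprojection `1 → n` at `i`. -/
def inj {n : ℕ} (i : Fin n) : L.Hom 1 n := L.incl fun _ => i

variable (L) in
/-- The projection `n → 1` at `i`. -/
def proj : ∀ {n : ℕ}, Fin n → L.Hom n 1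
  | 0 => fun i => i.elim0
  | n + 1 => Fin.lastCases (L.snd n 1) fun i => L.comp (L.fst n 1) (proj i)

theorem proj_last (n : ℕ) : L.proj (Fin.last n) = L.snd n 1 := by
  simp only [proj, Fin.lastCases_last]

theorem proj_castSucc {n : ℕ} (i : Fin n) :
    L.proj i.castSucc = L.comp (L.fst n 1) (L.proj i) := by
  simp only [proj, Fin.lastCases_castSucc]

theorem inj_comp_incl {n m : ℕ} (i : Fin n) (f : Fin n → Fin m) :
    L.comp (L.inj i) (L.incl f) = L.inj (f i) := (L.incl_comp _ _).symm

theorem inj_last (n : ℕ) : L.inj (Fin.last n) = L.inr n 1 :=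
  congrArg L.incl (funext fun j => by rw [Subsingleton.elim j 0]; rfl)

theorem inj_castSucc {n : ℕ} (i : Fin n) :
    L.inj i.castSucc = L.comp (L.inj i) (L.inl n 1) := (inj_comp_incl i _).symm

theorem inj_zero : L.inj (0 : Fin 1) = L.id 1 :=
  (congrArg L.incl (funext fun _ => Subsingleton.elim _ _)).trans (L.incl_id 1)

/-- Maps out of `n` are determined by their composites with the coprojections. -/
theorem hom_ext : ∀ {n m : ℕ} {f g : L.Hom n m},
    (∀ i, L.comp (L.inj i) f = L.comp (L.inj i) g) → f = g
  | 0, _, _, _, _ => L.initial_uniq _ _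
  | n + 1, m, f, g, h => by
    have key : ∀ f g : L.Hom (n + 1) m, (∀ i, L.comp (L.inj i) f = L.comp (L.inj i) g) →
        L.comp (L.inl n 1) f = L.comp (L.inl n 1) g ∧
          L.comp (L.inr n 1) f = L.comp (L.inr n 1) g := fun f g h =>
      ⟨hom_ext fun i => by simp only [← L.comp_assoc, ← inj_castSucc, h],
        by rw [← inj_last, h]⟩
    obtain ⟨h₁, h₂⟩ := key f g h
    exact (L.desc_uniq _ _ f h₁ h₂).trans (L.desc_uniq _ _ g rfl rfl).symm

/-- Induction on `n`, splitting `n + 1` as the biproduct of `n` and `1`: the last index sees only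
the summand `1`, and mixed pairs of indices give a composite through the zero object. -/
theorem inj_comp_proj : ∀ {n : ℕ} (i j : Fin n),
    L.comp (L.inj i) (L.proj j) = if i = j then L.id 1 else 0
  | 0, i, _ => i.elim0
  | n + 1, i, j => by
    induction i using Fin.lastCases with
    | last =>
      rw [inj_last]
      induction j using Fin.lastCases with
      | last => rw [proj_last, L.inr_snd, if_pos rfl]
      | cast j =>
        rw [proj_castSucc, ← L.comp_assoc, L.inr_fst, if_neg (Fin.castSucc_lt_last j).ne']
        exact zero_comp _
    | cast i =>
      rw [inj_castSucc]
      induction j using Fin.lastCases with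
      | last =>
        rw [proj_last, L.comp_assoc, L.inl_snd, if_neg (Fin.castSucc_lt_last i).ne]
        exact comp_zero _
      | cast j =>
        rw [proj_castSucc, L.comp_assoc, ← L.comp_assoc (L.inl n 1), L.inl_fst, L.id_comp,
          inj_comp_proj i j]
        simp only [Fin.castSucc_inj]

/-- Tested against the coprojection at `i`, the sum collapses to its `i`-th term by orthogonality.
-/
theorem id_eq_sum (n : ℕ) : L.id n = ∑ i, L.comp (L.proj i) (L.inj i) :=
  hom_ext fun i => by
    rw [L.comp_id, comp_sum, Finset.sum_eq_single i]
    · rw [← L.comp_assoc, inj_comp_proj, if_pos rfl, L.id_comp]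
    · intro j _ h
      rw [← L.comp_assoc, inj_comp_proj, if_neg h.symm]
      exact zero_comp _
    · exact fun h => (h (Finset.mem_univ i)).elim

/-! ### Entries of composites, structure maps and tensors. -/

/-- The entry `(i, j)` of a map `n → m`. -/
def entry {n m : ℕ} (f : L.Hom n m) (i : Fin n) (j : Fin m) : L.Scalars :=
  L.comp (L.inj i) (L.comp f (L.proj j))

theorem entry_comp {n m p : ℕ} (f : L.Hom n m) (g : L.Hom m p) (i : Fin n) (k : Fin p) :
    entry (L.comp f g) i k = ∑ j, entry f i j * entry g j k := by
  -- The identity of the middle object is inserted between `f` and `g` and expanded by `id_eq_sum`.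
  have h : L.comp f g = ∑ j, L.comp (L.comp f (L.proj j)) (L.comp (L.inj j) g) := by
    conv_lhs => rw [← L.id_comp g, id_eq_sum m, sum_comp, comp_sum]
    exact Finset.sum_congr rfl fun j _ => by simp only [L.comp_assoc]
  have h' : L.comp (L.inj i) (L.comp (L.comp f g) (L.proj k)) =
      ∑ j, L.comp (entry f i j) (entry g j k) := by
    rw [h, sum_comp, comp_sum]
    exact Finset.sum_congr rfl fun j _ => by simp only [entry, L.comp_assoc]
  exact h'

theorem entry_incl {n m : ℕ} (f : Fin n → Fin m) (i : Fin n) (j : Fin m) :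
    entry (L.incl f) i j = if f i = j then 1 else 0 := by
  rw [entry, ← L.comp_assoc, inj_comp_incl, inj_comp_proj]
  rfl

theorem entry_id {n : ℕ} (i j : Fin n) : entry (L.id n) i j = if i = j then 1 else 0 := by
  rw [← L.incl_id, entry_incl]

/-- The coprojection at `i` factors through one of the two summands, on which `π₁` is the identity
or zero. -/
theorem entry_fst (n m : ℕ) (i : Fin (n + m)) (j : Fin n) :
    entry (L.fst n m) i j = if i = Fin.castAdd m j then 1 else 0 := by
  induction i using Fin.addCases with
  | left i =>
    rw [entry, ← inj_comp_incl, L.comp_assoc, ← L.comp_assoc (L.incl _), ← Law.inl, L.inl_fst,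
      L.id_comp, inj_comp_proj]
    simp only [Fin.castAdd_inj]
    rfl
  | right i =>
    rw [entry, ← inj_comp_incl, L.comp_assoc, ← L.comp_assoc (L.incl _), ← Law.inr, L.inr_fst,
      if_neg (by simp only [Fin.ext_iff, Fin.val_natAdd, Fin.val_castAdd]; omega)]
    exact (congrArg (L.comp _) (zero_comp _)).trans (comp_zero _)

theorem entry_snd (n m : ℕ) (i : Fin (n + m)) (j : Fin m) :
    entry (L.snd n m) i j = if i = Fin.natAdd n j then 1 else 0 := by
  induction i using Fin.addCases with
  | left i =>
    rw [entry, ← inj_comp_incl, L.comp_assoc, ← L.comp_assoc (L.incl _), ← Law.inl, L.inl_snd,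
      if_neg (by simp only [Fin.ext_iff, Fin.val_natAdd, Fin.val_castAdd]; omega)]
    exact (congrArg (L.comp _) (zero_comp _)).trans (comp_zero _)
  | right i =>
    rw [entry, ← inj_comp_incl, L.comp_assoc, ← L.comp_assoc (L.incl _), ← Law.inr, L.inr_snd,
      L.id_comp, inj_comp_proj]
    simp only [Fin.natAdd_inj]
    rfl

theorem entry_scalar (s : L.Hom 1 1) (i j : Fin 1) : entry s i j = s := by
  -- By its recursion this projection is `snd 0 1`, not literally the identity; it is identified by
  -- pairing it with the coprojection, which is the identity.
  have hp : L.proj (0 : Fin 1) = L.id 1 := by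
    have h := inj_comp_proj (L := L) (0 : Fin 1) 0
    rwa [inj_zero, L.id_comp, if_pos rfl] at h
  rw [Subsingleton.elim i 0, Subsingleton.elim j 0, entry, inj_zero, L.id_comp, hp]
  exact L.comp_id _

/-- The Eckmann–Hilton argument: `s ⊗ t` is `s ⊗ id` followed by `id ⊗ t`, and each factor slides
past a unitor. The left and right unitors of `1` coincide because `Fin 1` has only one element. -/
theorem tensor_scalar (s t : L.Hom 1 1) :
    L.comp (L.tensor s t) (L.incl (Aleph.leftUnitor 1)) =
      L.comp (L.incl (Aleph.leftUnitor 1)) (L.comp s t) := by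
  have hu : L.incl (Aleph.rightUnitor 1) = L.incl (Aleph.leftUnitor 1) :=
    congrArg _ (funext fun _ => Subsingleton.elim _ _)
  have : L.tensor s t = L.comp (L.tensor s (L.id 1)) (L.tensor (L.id 1) t) := by
    rw [← L.tensor_comp, L.comp_id, L.id_comp]
  rw [this, L.comp_assoc, L.leftUnitor_natural, ← L.comp_assoc, ← hu, L.rightUnitor_natural,
    L.comp_assoc]

theorem inj_prod {n m : ℕ} (a : Fin n) (b : Fin m) : L.inj (finProdFinEquiv (a, b)) =
    L.comp (L.incl (Aleph.leftUnitor 1).symm) (L.tensor (L.inj a) (L.inj b)) := by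
  rw [inj, inj, inj, L.tensor_incl, ← L.incl_comp]
  rfl

/-- By interchange the composite is the tensor of two scalars, conjugated by the unitor. The tensor
of projections stands in for the projection of the product because `proj_prod`, which identifies
them, is itself deduced from the case of identities. -/
theorem tensor_entry {n m p q : ℕ} (f : L.Hom n p) (g : L.Hom m q) (a : Fin n) (b : Fin m)
    (c : Fin p) (d : Fin q) :
    L.comp (L.inj (finProdFinEquiv (a, b))) (L.comp (L.tensor f g)
      (L.comp (L.tensor (L.proj c) (L.proj d)) (L.incl (Aleph.leftUnitor 1)))) =
      L.comp (entry f a c) (entry g b d) := by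
  have hinv : L.comp (L.incl (Aleph.leftUnitor 1).symm) (L.incl (Aleph.leftUnitor 1)) = L.id 1 :=
    (L.inclIso (Aleph.leftUnitor 1)).inv_hom_id
  rw [inj_prod, L.comp_assoc, ← L.comp_assoc (L.tensor f g), ← L.tensor_comp,
    ← L.comp_assoc (L.tensor (L.inj a) _), ← L.tensor_comp, tensor_scalar, ← L.comp_assoc, hinv,
    L.id_comp]
  rfl

/-- Unlike `inj_prod`, this cannot be computed in `ℵ₀`, as projections do not in general come from
functions. Instead both sides are tested against the coprojections, where they give `δ` of pairs and
a product of two `δ`s. -/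
theorem proj_prod {n m : ℕ} (c : Fin n) (d : Fin m) : L.proj (finProdFinEquiv (c, d)) =
    L.comp (L.tensor (L.proj c) (L.proj d)) (L.incl (Aleph.leftUnitor 1)) :=
  hom_ext fun i => by
    obtain ⟨⟨a, b⟩, rfl⟩ := finProdFinEquiv.surjective i
    have h := tensor_entry (L.id n) (L.id m) a b c d
    rw [L.tensor_id, L.id_comp] at h
    rw [h, inj_comp_proj, entry_id, entry_id]
    change _ = (_ * _ : L.Scalars)
    simp only [EmbeddingLike.apply_eq_iff_eq, Prod.mk.injEq, ite_and, ite_mul, one_mul, zero_mul]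
    rfl

theorem entry_tensor {n m p q : ℕ} (f : L.Hom n p) (g : L.Hom m q) (a : Fin n) (b : Fin m)
    (c : Fin p) (d : Fin q) :
    entry (L.tensor f g) (finProdFinEquiv (a, b)) (finProdFinEquiv (c, d)) =
      entry f a c * entry g b d := by
  rw [entry, proj_prod]
  exact tensor_entry f g a b c d

/-- Expanding the identity of `m` behind `f` writes each row of `f` as a combination of
coprojections, with the entries as coefficients. -/
theorem entry_injective {n m : ℕ} {f g : L.Hom n m} (h : ∀ i j, entry f i j = entry g i j) :
    f = g := by
  refine hom_ext fun i => ?_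
  have key : ∀ f : L.Hom n m, L.comp (L.inj i) f = ∑ j, L.comp (entry f i j) (L.inj j) :=
    fun f => by
      conv_lhs => rw [← L.comp_id f, id_eq_sum m, comp_sum, comp_sum]
      exact Finset.sum_congr rfl fun j _ => by simp only [entry, L.comp_assoc]
  rw [key, key]
  simp only [h]

/-- The map with prescribed entries. -/
def ofEntries {n m : ℕ} (A : Matrix (Fin n) (Fin m) L.Scalars) : L.Hom n m :=
  ∑ i, ∑ j, L.comp (L.proj i) (L.comp (A i j) (L.inj j))

theorem entry_ofEntries {n m : ℕ} (A : Matrix (Fin n) (Fin m) L.Scalars) (i : Fin n)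
    (j : Fin m) : entry (ofEntries A) i j = A i j := by
  -- Orthogonality on both sides kills every term of the double sum except the one at `(i, j)`.
  have key : ∀ k l (a : L.Hom 1 1), L.comp (L.inj i) (L.comp (L.comp (L.proj k)
      (L.comp a (L.inj l))) (L.proj j)) = if i = k then (if l = j then a else 0) else 0 :=
    fun k l a => by
      rw [L.comp_assoc, L.comp_assoc, inj_comp_proj, ← L.comp_assoc, inj_comp_proj]
      split_ifs
      · rw [L.id_comp, L.comp_id]
      · rw [L.id_comp]; exact comp_zero _
      · exact zero_comp _
      · exact zero_comp _
  have h : L.comp (L.inj i) (L.comp (ofEntries A) (L.proj j)) =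
      ∑ k, ∑ l, if i = k then (if l = j then (A k l : L.Hom 1 1) else 0) else 0 := by
    simp only [ofEntries, sum_comp, comp_sum]
    exact Finset.sum_congr rfl fun k _ => Finset.sum_congr rfl fun l _ => key k l (A k l)
  refine h.trans ?_
  rw [Finset.sum_eq_single i (fun k _ h => Finset.sum_eq_zero fun l _ => if_neg h.symm) (by simp),
    Finset.sum_eq_single j (fun l _ h => by rw [if_pos rfl, if_neg h]) (by simp), if_pos rfl,
    if_pos rfl]

end Entries

/-! ### Every theory is naturally a theory of matrices. -/

section Morphisms

variable {L K : SMBLaw.{u}}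

/-- A projection is determined by its composites with the coprojections. These composites are
identities or zeros, and `F` preserves both. -/
theorem map_proj (F : Morphism L K) {n : ℕ} (j : Fin n) : F.map (L.proj j) = K.proj j :=
  hom_ext fun i => by
    have h : F.map (L.inj i) = K.inj i := F.map_incl _
    rw [← h, ← F.map_comp, h, inj_comp_proj, inj_comp_proj, apply_ite F.map, F.map_id]
    exact congrArg (ite (i = j) (K.id 1)) (map_zero F 1 1)

theorem map_entry (F : L ⟶ K) {n m : ℕ} (f : L.Hom n m) (i : Fin n) (j : Fin m) :
    scalarsMap F (entry f i j) = entry (Morphism.map F f) i j := by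
  change Morphism.map F (L.comp _ (L.comp _ _)) = _
  rw [Morphism.map_comp, Morphism.map_comp, map_proj, inj, Morphism.map_incl]
  rfl

/-- A morphism of theories that is bijective on maps is an isomorphism. -/
def isoOfInverse (F : L ⟶ K) (G : ∀ {n m : ℕ}, K.Hom n m → L.Hom n m)
    (hFG : ∀ {n m : ℕ} (f : L.Hom n m), G (Morphism.map F f) = f)
    (hGF : ∀ {n m : ℕ} (f : K.Hom n m), Morphism.map F (G f) = f) : L ≅ K where
  hom := F
  inv :=
    { map := G
      map_id := fun n => by rw [← Morphism.map_id F, hFG]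
      map_comp := fun f g => by rw [← hFG (L.comp _ _), Morphism.map_comp, hGF, hGF]
      map_incl := fun f => by rw [← Morphism.map_incl F, hFG]
      map_tensor := fun f g => by rw [← hFG (L.tensor _ _), Morphism.map_tensor, hGF, hGF]
      map_fst := fun n m => by rw [← Morphism.map_fst F, hFG]
      map_snd := fun n m => by rw [← Morphism.map_snd F, hFG] }
  hom_inv_id := Morphism.ext <| by
    funext _ _ f
    exact hFG f
  inv_hom_id := Morphism.ext <| by
    funext n m f
    exact hGF f

variable (L) in
/-- The morphism that sends a map to the matrix of its entries. -/
def entriesHom : L ⟶ Mat.theory L.Scalars where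
  map f := (Matrix.of (entry f) : Matrix _ _ L.Scalars)
  map_id _ := Matrix.ext fun i j => (entry_id i j).trans Matrix.one_apply.symm
  map_comp f g := Matrix.ext fun i j =>
    (entry_comp f g i j).trans (Matrix.mul_apply (α := L.Scalars)).symm
  map_incl f := Matrix.ext fun i j => entry_incl f i j
  map_tensor f g := Mat.tensor_ext fun a b c d =>
    (entry_tensor f g a b c d).trans (Mat.tensor_apply (S := L.Scalars) _ _ a b c d).symm
  map_fst n m := Matrix.ext fun i j => entry_fst n m i j
  map_snd n m := Matrix.ext fun i j => entry_snd n m i j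

variable (L) in
/-- A theory with biproducts is isomorphic to the theory of matrices over its scalars. -/
def entriesIso : L ≅ Mat.theory L.Scalars :=
  isoOfInverse (entriesHom L) ofEntries
    (fun _ => entry_injective fun i j => entry_ofEntries _ i j)
    (fun A => Matrix.ext fun i j => entry_ofEntries A i j)

theorem entriesIso_naturality (F : L ⟶ K) :
    F ≫ (entriesIso K).hom = (entriesIso L).hom ≫ Mat.theoryMap (scalarsMap F) :=
  Morphism.ext <| by
    funext n m f
    exact Matrix.ext fun i j => (map_entry F f i j).symm

/-- Naturality of the counit, obtained by inverting the naturality of taking entries. -/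
theorem ofEntries_naturality (F : L ⟶ K) :
    Mat.theoryMap (scalarsMap F) ≫ (entriesIso K).inv = (entriesIso L).inv ≫ F :=
  (Iso.comp_inv_eq _).2 <| by
    rw [Category.assoc, entriesIso_naturality, Iso.inv_hom_id_assoc]

end Morphisms

end SMBLaw

/-! ### Scalars and entries in `Mat(S)`; the triangle identities. -/

namespace Mat

variable {S : Type u} [CommSemiring S]

theorem theory_add {n m : ℕ} (f g : Matrix (Fin n) (Fin m) S) : (theory S).add f g = f + g := by
  refine (SMBLaw.add_eq_desc (L := theory S) f g).trans ?_
  refine Matrix.ext fun i j => (Matrix.mul_apply (α := S)).trans ?_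
  -- The diagonal is two identity matrices side by side and the cotuple stacks `f` on `g`, so the
  -- sum over `n + n` splits into two halves, each with a single surviving term.
  rw [Fin.sum_univ_add]
  simp [theory, lift, desc, Matrix.one_apply, -Fin.natAdd_eq_addNat]

theorem theory_zero (n m : ℕ) : (theory S).zero n m = (0 : Matrix (Fin n) (Fin m) S) :=
  Matrix.zero_mul (α := S) _

variable (S) in
/-- The inclusion of a commutative semiring into the scalars of its theory of matrices. -/
def scalarHom : S →+* (theory S).Scalars where
  toFun := scalar
  map_one' := Matrix.ext fun i j => by
    rw [Subsingleton.elim i j]; exact (Matrix.one_apply_eq (α := S) j).symm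
  map_mul' s t := Matrix.ext fun i j =>
    ((Matrix.mul_apply (α := S) (M := scalar s) (N := scalar t)).trans (Fin.sum_univ_one _)).symm
  map_zero' := (theory_zero 1 1).symm
  map_add' s t := (theory_add (scalar s) (scalar t)).symm

theorem theory_proj {n : ℕ} (i : Fin n) :
    (theory S).proj i = (Matrix.of fun k _ => if k = i then 1 else 0 : Matrix _ _ S) :=
  SMBLaw.hom_ext fun j => by
    rw [SMBLaw.inj_comp_proj]
    refine Eq.trans ?_ (incl_comp _ _).symm
    split_ifs with h
    · exact Matrix.ext fun a b => by
        rw [Subsingleton.elim a b]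
        exact (Matrix.one_apply_eq (α := S) b).trans (if_pos h).symm
    · exact (theory_zero 1 1).trans (Matrix.ext fun a b => (if_neg h).symm)

theorem entry_theory {n m : ℕ} (A : Matrix (Fin n) (Fin m) S) (i : Fin n) (j : Fin m) :
    SMBLaw.entry (L := theory S) A i j = scalar (A i j) := by
  refine (congrArg (fun P => (theory S).comp ((theory S).inj i) ((theory S).comp A P))
    (theory_proj j)).trans ?_
  refine (incl_comp _ _).trans (Matrix.ext fun a b => ?_)
  change ∑ k, A i k * (if k = j then (1 : S) else 0) = A i j
  simp

/-- The left triangle identity in disguise: `Mat` of the unit is the inverse of the counit at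
`Mat(S)`. -/
theorem theoryMap_scalarHom (S : Type u) [CommSemiring S] :
    theoryMap (scalarHom S) = (SMBLaw.entriesIso (theory S)).hom :=
  SMBLaw.Morphism.ext <| by
    funext n m A
    exact Matrix.ext fun i j => (entry_theory A i j).symm

end Mat

/-- This is the right triangle identity, evaluated at a scalar. -/
theorem SMBLaw.entriesInv_scalar {L : SMBLaw.{u}} (s : L.Scalars) :
    (SMBLaw.entriesIso L).inv.map (Mat.scalar s) = s :=
  entry_injective fun i j => (entry_ofEntries _ i j).trans (entry_scalar s i j).symm

/-! ### A dagger acts on entries as conjugate transposition. -/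

namespace SMBLaw.IsDagger

variable {L : SMBLaw.{u}} {dag : ∀ {n m : ℕ}, L.Hom n m → L.Hom m n}

/-- Since `π_i† = κ_i`, the dagger turns the equations that characterise a tuple into those of a
cotuple. -/
theorem dag_lift (h : L.IsDagger dag) {n m p : ℕ} (f : L.Hom p n) (g : L.Hom p m) :
    dag (L.lift f g) = L.desc (dag f) (dag g) :=
  L.desc_uniq _ _ _
    (by rw [← Law.inl, ← h.dag_fst, ← h.dag_comp, L.lift_fst])
    (by rw [← Law.inr, ← h.dag_snd, ← h.dag_comp, L.lift_snd])

theorem dag_desc (h : L.IsDagger dag) {n m p : ℕ} (f : L.Hom n p) (g : L.Hom m p) :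
    dag (L.desc f g) = L.lift (dag f) (dag g) := by
  rw [← h.dag_dag (L.lift _ _), h.dag_lift, h.dag_dag, h.dag_dag]

/-- The dagger exchanges diagonal and codiagonal, hence the two descriptions `add_eq_desc` and
`add_eq_lift` of the same sum. -/
theorem dag_add (h : L.IsDagger dag) {n m : ℕ} (f g : L.Hom n m) :
    dag (L.add f g) = L.add (dag f) (dag g) := by
  rw [add_eq_desc, h.dag_comp, h.dag_lift, h.dag_desc, h.dag_id, add_eq_lift]

theorem dag_zero (h : L.IsDagger dag) (n m : ℕ) : dag (L.zero n m) = L.zero m n := by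
  rw [zero, h.dag_comp, zero, L.terminal_uniq (dag _) (L.toZero m)]
  exact congrArg _ (L.initial_uniq _ _)

theorem dag_proj (h : L.IsDagger dag) : ∀ {n : ℕ} (i : Fin n), dag (L.proj i) = L.inj i
  | 0, i => i.elim0
  | n + 1, i => by
    induction i using Fin.lastCases with
    | last => rw [proj_last, h.dag_snd, inj_last]
    | cast i => rw [proj_castSucc, h.dag_comp, h.dag_proj i, h.dag_fst, inj_castSucc]

/-- The dagger reverses `π_j ∘ f ∘ κ_i` and swaps projections with coprojections, so the indices
change places. -/
theorem dag_entry (h : L.IsDagger dag) {n m : ℕ} (f : L.Hom n m) (i : Fin n) (j : Fin m) :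
    dag (entry f i j) = entry (dag f) j i := by
  rw [entry, h.dag_comp, h.dag_comp, h.dag_proj, ← h.dag_proj i, h.dag_dag, L.comp_assoc]
  rfl

/-- This is what makes the counit a morphism of theories with dagger. -/
theorem ofEntries_conjTranspose (h : L.IsDagger dag) {n m : ℕ}
    (A : Matrix (Fin n) (Fin m) L.Scalars) :
    ofEntries (Matrix.of fun j i => (dag (A i j : L.Hom 1 1) : L.Hom 1 1)) = dag (ofEntries A) :=
  entry_injective fun j i => by
    rw [entry_ofEntries, ← h.dag_entry, entry_ofEntries]
    rfl

theorem isInvolution (h : L.IsDagger dag) :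
    IsInvolution (R := L.Scalars) (dag (n := 1) (m := 1)) where
  map_add := h.dag_add (n := 1) (m := 1)
  map_zero := h.dag_zero 1 1
  -- The dagger reverses composites, which is harmless because scalars commute.
  map_mul s t := (h.dag_comp (n := 1) (m := 1) (p := 1) s t).trans (comp_comm_one _ _)
  map_one := h.dag_id 1
  inv_inv := h.dag_dag (n := 1) (m := 1)

end SMBLaw.IsDagger

/-! ### Conjugate transposition is a dagger on `Mat(S)`. -/

namespace Mat

/-- A permutation matrix has entries `0` and `1`, fixed by the involution, and its transpose is its
inverse. This settles all the coherence isomorphisms at once. -/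
theorem conjTranspose_incl (S : ICSRng.{u}) {n m : ℕ} (e : Fin n ≃ Fin m) :
    conjTranspose S ((theory S).incl e) = (theory S).incl e.symm := by
  refine Matrix.ext fun i j => ?_
  change star (if e j = i then (1 : S) else 0) = if e.symm i = j then 1 else 0
  simp only [Equiv.symm_apply_eq, eq_comm (a := i), apply_ite star, star_one, star_zero]

theorem isDagger_conjTranspose (S : ICSRng.{u}) : (theory S).IsDagger (conjTranspose S) where
  dag_id n := Matrix.conjTranspose_one (α := S)
  dag_comp f g := Matrix.conjTranspose_mul (α := S) f g
  dag_dag f := Matrix.conjTranspose_conjTranspose (α := S) f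
  dag_tensor f g := tensor_ext fun a b c d => by
    refine (congrArg star (tensor_apply (S := S) f g c d a b)).trans ?_
    -- The star of a product keeps the order of the factors, by commutativity of `S`.
    rw [star_mul']
    exact (tensor_apply (S := S) (conjTranspose S f) (conjTranspose S g) a b c d).symm
  dag_assoc n m k := conjTranspose_incl S _
  dag_leftUnitor n := conjTranspose_incl S _
  dag_rightUnitor n := conjTranspose_incl S _
  dag_braid n m := conjTranspose_incl S _
  dag_fst _ m := Matrix.ext fun i j => by
    change star (if j = Fin.castAdd m i then (1 : S) else 0) = if Fin.castAdd m i = j then 1 else 0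
    simp only [eq_comm (a := j), apply_ite star, star_one, star_zero]
  dag_snd n _ := Matrix.ext fun i j => by
    change star (if j = Fin.natAdd n i then (1 : S) else 0) = if Fin.natAdd n i = j then 1 else 0
    simp only [eq_comm (a := j), apply_ite star, star_one, star_zero]

theorem theoryMap_conjTranspose {S R : ICSRng.{u}} (f : S ⟶ R) {n m : ℕ}
    (h : (theory S).Hom n m) :
    (theoryMap f.hom).map (conjTranspose S h) = conjTranspose R ((theoryMap f.hom).map h) :=
  Matrix.ext fun _ _ => f.map_inv _

end Mat

/-! ### The adjunctions -/

/-- The adjunction `Mat ⊣ H`. -/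
def matAdjunction : matFunctor.{u} ⊣ scalarsFunctor.{u} :=
  Adjunction.mkOfUnitCounit
    { unit :=
        { app := fun S => CommSemiRingCat.ofHom (Mat.scalarHom S)
          naturality := fun _ _ _ => rfl }
      counit :=
        { app := fun L => (SMBLaw.entriesIso L).inv
          naturality := fun _ _ F => SMBLaw.ofEntries_naturality F }
      left_triangle := by
        ext S : 2
        refine (congrArg (· ≫ (SMBLaw.entriesIso (Mat.theory S)).inv)
          (Mat.theoryMap_scalarHom S)).trans ?_
        exact Iso.hom_inv_id _
      right_triangle := by
        ext L s
        exact SMBLaw.entriesInv_scalar s }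

/-- `Mat` as a functor from involutive commutative semirings to theories with a dagger. -/
abbrev matDagger : ICSRng.{u} ⥤ DSMBLaw.{u} :=
  matDaggerFunctor Mat.isDagger_conjTranspose Mat.theoryMap_conjTranspose

/-- `H` as a functor from theories with a dagger to involutive commutative semirings. -/
abbrev scalarsInv : DSMBLaw.{u} ⥤ ICSRng.{u} :=
  scalarsInvFunctor (fun L => L.isDagger.isInvolution) fun F s => F.map_dag (n := 1) (m := 1) s

/-- The adjunction `Mat ⊣ H` restricted to involutive semirings and theories with a dagger. -/
def matDaggerAdjunction : matDagger.{u} ⊣ scalarsInv.{u} :=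
  Adjunction.mkOfUnitCounit
    { unit :=
        -- The conjugate transpose of the matrix `(s)` is `(s*)` by definition.
        { app := fun S => ⟨Mat.scalarHom S, fun _ => rfl⟩
          naturality := fun _ _ _ => rfl }
      counit :=
        { app := fun L =>
            ⟨(SMBLaw.entriesIso L.toSMBLaw).inv, fun A => L.isDagger.ofEntries_conjTranspose A⟩
          naturality := fun _ _ F => DSMBLaw.Morphism.ext (SMBLaw.ofEntries_naturality F.hom) }
      -- Both triangle identities are equations between underlying morphisms, where they are those
      -- of `matAdjunction`.
      left_triangle := NatTrans.ext <| funext fun S => DSMBLaw.Morphism.ext <|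
        matAdjunction.left_triangle_components (forgetInv.obj S)
      right_triangle := NatTrans.ext <| funext fun L => ICSRng.Morphism.ext <|
        congrArg CommSemiRingCat.Hom.hom
          (matAdjunction.right_triangle_components (forgetDagger.obj L)) }

end LawTheory

theorem mainTheorem10 :
    ∃ (hMat : ∀ S : ICSRng.{u}, (Mat.theory S).IsDagger (Mat.conjTranspose S))
      (hMatMap : ∀ {S R : ICSRng.{u}} (f : S ⟶ R) {n m : ℕ} (h : (Mat.theory S).Hom n m),
        (Mat.theoryMap f.hom).map (Mat.conjTranspose S h) =
          Mat.conjTranspose R ((Mat.theoryMap f.hom).map h))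
      (hH : ∀ L : DSMBLaw.{u}, IsInvolution L.scalarsInv)
      (hHMap : ∀ {L K : DSMBLaw.{u}} (F : L ⟶ K) (s : L.Scalars),
        SMBLaw.scalarsMap F.hom (L.scalarsInv s) = K.scalarsInv (SMBLaw.scalarsMap F.hom s)),
      -- the functors so obtained are restrictions of `Mat` and `H`
      matDaggerFunctor hMat hMatMap ⋙ forgetDagger = forgetInv ⋙ matFunctor.{u} ∧
      scalarsInvFunctor hH hHMap ⋙ forgetInv = forgetDagger ⋙ scalarsFunctor.{u} ∧
      -- the adjunction `Mat ⊣ H` and its restriction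
      ∃ (adj : matFunctor.{u} ⊣ scalarsFunctor.{u})
        (adj' : matDaggerFunctor hMat hMatMap ⊣ scalarsInvFunctor hH hHMap),
        (∀ (S : CommSemiRingCat.{u}) (L : SMBLaw.{u}) (F : matFunctor.obj S ⟶ L) (s : S),
          (adj.homEquiv S L F).hom s = SMBLaw.Morphism.map F (Mat.scalar s)) ∧
        (∀ S : ICSRng.{u}, forgetInv.map (adj'.unit.app S) = adj.unit.app (forgetInv.obj S)) ∧
        (∀ L : DSMBLaw.{u},
          forgetDagger.map (adj'.counit.app L) = adj.counit.app (forgetDagger.obj L)) := by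
  refine ⟨Mat.isDagger_conjTranspose, Mat.theoryMap_conjTranspose, fun L => L.isDagger.isInvolution,
    fun F s => F.map_dag (n := 1) (m := 1) s, rfl, rfl, matAdjunction, matDaggerAdjunction,
    fun S L F s => ?_, fun _ => rfl, fun _ => rfl⟩
  -- The transpose of `F` is the unit followed by the restriction of `F` to scalars, and the unit
  -- sends `s` to the matrix `(s)`.
  rw [Adjunction.homEquiv_unit]
  rfl
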